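/- (Internal Stability) Consider the fully observed system $x_{t+1}=Ax_t+Bu_t+w_{t+1}$, $y_t=x_t$, with $A\in\mathbb R^{n\times n}$, $B\in\mathbb R^{n\times p}$ and $w_t$ i.i.d. random vectors in $\mathbb R^n$ with $\mathbb E\|w_t\|_2^4<\infty$. Let $\bar w=\mathbb E w_t$, $\delta_t=w_t-\bar w$, $W=\mathbb E\,\delta_t\delta_t'$. Let $Q\succeq 0$ and $R\succ 0$ be symmetric, $(A,B)$ stabilizable and $(A,Q^{1/2})$ detectable. Put $m_3=2Q\,\mathbb E\{\delta_t\delta_t'Q\delta_t\}$, fix $\mu\ge 0$ and put $Q_\mu=Q+4\mu QWQ$. For a horizon $N$ define, backwards in $t$ from $V_N=Q_\mu$, $\xi_N=\mu m_3$, for $t=N,\dots,1$, \begin{align*} V_{t-1}&=A'V_tA+Q_\mu-A'V_tB(B'V_tB+R)^{-1}B'V_tA,\\ K_{t-1}&=-(B'V_tB+R)^{-1}B'V_tA,\\ \xi_{t-1}&=(A+BK_{t-1})'(\xi_t+V_t\bar w)+\mu m_3,\\ l_{t-1}&=-(B'V_tB+R)^{-1}B'(\xi_t+V_t\bar w) \end{align*}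 (the coefficients of the risk-aware policy $u_t^*(\mu)=K_tx_t+l_t$). Then all matrices $B'V_tB+R$ are invertible, and the algebraic Riccati equation $$V=A'VA+Q_\mu-A'VB(B'VB+R)^{-1}B'VA$$ has exactly one stabilizing solution, i.e. exactly one symmetric solution $V$ with $B'VB+R$ invertible for which $A+BK$, $K=-(B'VB+R)^{-1}B'VA$, is stable (spectral radius $\rho(A+BK)<1$). Moreover $V\succeq0$, the matrix $I-(A+BK)'$ is invertible, and, with $$\xi=(I-(A+BK)')^{-1}\{(A+BK)'V\bar w+\mu m_3\},\qquad l=-(B'VB+R)^{-1}B'(\xi+V\bar w),$$ one has, as $N\to\infty$, for every $t\ge0$, $V_t\to V$, $K_t\to K$, $\xi_t\to\xi$, $l_t\to l$ exponentially fast: there are constants $C>0$ and $\rho\in(0,1)$, independent of $N$ and $t$, such that $\|V_t-V\|$, $\|K_t-K\|$, $\|\xi_t-\xi\|$ and $\|l_t-l\|$ are all at most $C\rho^{N-t}$ whenever $0\le t<N$ (Euclidean norms for vectors, spectral norms for matrices). -/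

import Mathlib

open MeasureTheory ProbabilityTheory
open scoped Matrix Matrix.Norms.L2Operator MatrixOrder

noncomputable section

namespace RiskLQR

/-! ### Linear systems notions -/

/-- A real square matrix is (Schur) stable if its spectral radius, i.e. the largest modulus of its
complex eigenvalues, is smaller than one. -/
def IsSchurStable {n : ℕ} (M : Matrix (Fin n) (Fin n) ℝ) : Prop :=
  spectralRadius ℂ (M.map Complex.ofReal) < 1

/-- `(A, B)` is stabilizable: some state feedback makes `A + B F` stable. -/
def IsStabilizable {n p : ℕ} (A : Matrix (Fin n) (Fin n) ℝ) (B : Matrix (Fin n) (Fin p) ℝ) :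
    Prop :=
  ∃ F : Matrix (Fin p) (Fin n) ℝ, IsSchurStable (A + B * F)

/-- `(A, C)` is detectable: some output injection makes `A + L C` stable. -/
def IsDetectable {n m : ℕ} (A : Matrix (Fin n) (Fin n) ℝ) (C : Matrix (Fin m) (Fin n) ℝ) :
    Prop :=
  ∃ L : Matrix (Fin n) (Fin m) ℝ, IsSchurStable (A + L * C)

/-! ### Noise moments -/

section Noise

variable {n : ℕ} {Ω : Type*} [MeasurableSpace Ω]

/-- The mean `E X` of a random vector. -/
def meanVec (P : Measure Ω) (X : Ω → EuclideanSpace ℝ (Fin n)) : Fin n → ℝ :=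
  fun i => ∫ ω, X ω i ∂P

/-- The centered vector `δ = X - E X`. -/
def centered (P : Measure Ω) (X : Ω → EuclideanSpace ℝ (Fin n)) (ω : Ω) : Fin n → ℝ :=
  fun i => X ω i - meanVec P X i

/-- The covariance matrix `E (δ δ')`. -/
def covMat (P : Measure Ω) (X : Ω → EuclideanSpace ℝ (Fin n)) : Matrix (Fin n) (Fin n) ℝ :=
  Matrix.of fun i j => ∫ ω, centered P X ω i * centered P X ω j ∂P

/-- The weighted third moment `m₃ = 2 Q E (δ δ' Q δ)`. -/
def thirdMoment (P : Measure Ω) (Q : Matrix (Fin n) (Fin n) ℝ)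
    (X : Ω → EuclideanSpace ℝ (Fin n)) : Fin n → ℝ :=
  (2 : ℝ) • (Q *ᵥ fun i => ∫ ω, centered P X ω i * (centered P X ω ⬝ᵥ (Q *ᵥ centered P X ω)) ∂P)

end Noise

/-- The inflated state penalty `Q_μ = Q + 4 μ Q W Q`. -/
def inflated {n : ℕ} (μ : ℝ) (Q W : Matrix (Fin n) (Fin n) ℝ) : Matrix (Fin n) (Fin n) ℝ :=
  Q + (4 * μ) • (Q * W * Q)

/-! ### Riccati recursions

`S` is the state penalty (to be taken `Q_μ`), `c` the linear penalty (to be taken `μ m₃`) and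
`wbar` the mean of the noise. -/

section Riccati

variable {n p : ℕ} (A : Matrix (Fin n) (Fin n) ℝ) (B : Matrix (Fin n) (Fin p) ℝ)
  (R : Matrix (Fin p) (Fin p) ℝ) (S : Matrix (Fin n) (Fin n) ℝ) (c wbar : Fin n → ℝ)

/-- The feedback gain `-(B'VB + R)⁻¹ B'VA`. -/
def gain (V : Matrix (Fin n) (Fin n) ℝ) : Matrix (Fin p) (Fin n) ℝ :=
  -((Bᵀ * V * B + R)⁻¹ * Bᵀ * V * A)

/-- The affine input term `-(B'VB + R)⁻¹ B'(ξ + V wbar)`. -/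
def affineTerm (V : Matrix (Fin n) (Fin n) ℝ) (ξ : Fin n → ℝ) : Fin p → ℝ :=
  -(((Bᵀ * V * B + R)⁻¹ * Bᵀ) *ᵥ (ξ + V *ᵥ wbar))

/-- The Riccati map `V ↦ A'VA + S - A'VB (B'VB + R)⁻¹ B'VA`. -/
def riccatiMap (V : Matrix (Fin n) (Fin n) ℝ) : Matrix (Fin n) (Fin n) ℝ :=
  Aᵀ * V * A + S - Aᵀ * V * B * (Bᵀ * V * B + R)⁻¹ * Bᵀ * V * A

/-- The Riccati iterate with `j` stages to go. -/
def riccatiToGo : ℕ → Matrix (Fin n) (Fin n) ℝ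
  | 0 => S
  | j + 1 => riccatiMap A B R S (riccatiToGo j)

/-- The linear cost-to-go coefficient with `j` stages to go. -/
def xiToGo : ℕ → (Fin n → ℝ)
  | 0 => c
  | j + 1 => (A + B * gain A B R (riccatiToGo A B R S j))ᵀ *ᵥ
      (xiToGo j + riccatiToGo A B R S j *ᵥ wbar) + c

/-- `V_t` for the horizon `N` (meaningful for `t ≤ N`). -/
def Vseq (N t : ℕ) : Matrix (Fin n) (Fin n) ℝ := riccatiToGo A B R S (N - t)

/-- `ξ_t` for the horizon `N` (meaningful for `t ≤ N`). -/
def xiSeq (N t : ℕ) : Fin n → ℝ := xiToGo A B R S c wbar (N - t)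

/-- `K_t` for the horizon `N` (meaningful for `t < N`). -/
def Kseq (N t : ℕ) : Matrix (Fin p) (Fin n) ℝ := gain A B R (Vseq A B R S N (t + 1))

/-- `l_t` for the horizon `N` (meaningful for `t < N`). -/
def lSeq (N t : ℕ) : Fin p → ℝ :=
  affineTerm B R wbar (Vseq A B R S N (t + 1)) (xiSeq A B R S c wbar N (t + 1))

/-! The sequences just defined satisfy the backward recursions with their terminal values. -/

theorem Vseq_terminal (N : ℕ) : Vseq A B R S N N = S := by
  simp [Vseq, riccatiToGo]

theorem Vseq_step {N t : ℕ} (h : t < N) :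
    Vseq A B R S N t = riccatiMap A B R S (Vseq A B R S N (t + 1)) := by
  obtain ⟨j, rfl⟩ := Nat.exists_eq_add_of_lt h
  have h1 : t + j + 1 - t = j + 1 := by omega
  have h2 : t + j + 1 - (t + 1) = j := by omega
  simp only [Vseq, h1, h2, riccatiToGo]

theorem xiSeq_terminal (N : ℕ) : xiSeq A B R S c wbar N N = c := by
  simp [xiSeq, xiToGo]

theorem xiSeq_step {N t : ℕ} (h : t < N) :
    xiSeq A B R S c wbar N t = (A + B * Kseq A B R S N t)ᵀ *ᵥ
      (xiSeq A B R S c wbar N (t + 1) + Vseq A B R S N (t + 1) *ᵥ wbar) + c := by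
  obtain ⟨j, rfl⟩ := Nat.exists_eq_add_of_lt h
  have h1 : t + j + 1 - t = j + 1 := by omega
  have h2 : t + j + 1 - (t + 1) = j := by omega
  simp only [xiSeq, Kseq, Vseq, h1, h2, xiToGo]

/-- `V` is a stabilizing solution of the discrete algebraic Riccati equation: a symmetric solution
whose feedback gain renders the closed loop stable. -/
structure IsStabilizingSolution (V : Matrix (Fin n) (Fin n) ℝ) : Prop where
  symm : V.IsSymm
  isUnit : IsUnit (Bᵀ * V * B + R)
  dare : V = riccatiMap A B R S V
  stable : IsSchurStable (A + B * gain A B R V)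

/-- The limit `(I - (A + BK)')⁻¹ ((A + BK)' V wbar + c)` of `ξ_t`, with `K` the gain of `V`. -/
def xiLimit (V : Matrix (Fin n) (Fin n) ℝ) : Fin n → ℝ :=
  (1 - (A + B * gain A B R V)ᵀ)⁻¹ *ᵥ ((A + B * gain A B R V)ᵀ *ᵥ (V *ᵥ wbar) + c)

end Riccati

/-- Horizon-indexed quantities `X N t`, `t < N`, converge to `L` exponentially fast:
`‖X N t - L‖ ≤ C ρ ^ (N - t)` with `ρ < 1` and with `C`, `ρ` independent of both `N` and `t`. -/
def ConvergesExp {E : Type*} [NormedAddCommGroup E] (X : ℕ → ℕ → E) (L : E) : Prop :=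
  ∃ C ρ : ℝ, 0 < C ∧ 0 < ρ ∧ ρ < 1 ∧ ∀ N t : ℕ, t < N → ‖X N t - L‖ ≤ C * ρ ^ (N - t)

end RiskLQR

end

noncomputable section

namespace RiskLQR

/-! ### Exponentially decaying sequences -/

/-! Write S for the state penalty, X j for the Riccati iterate with j stages to go, K j for its
gain, and T = A + BK for the limiting closed loop.

Convergence: completing the square (`feedbackCost_eq`) shows that the Riccati map is the minimum,
over feedbacks F, of the one-stage costs `feedbackCost`. It is therefore monotone, and since S lies
below its own image, X j increases. A stabilizing F gives an upper bound obeying a stable affine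
recursion, hence bounded. So X j converges, and by continuity its limit V is a positive semidefinite
solution of the Riccati equation.

Stability: the Riccati equation tested on an eigenvector v of T with eigenvalue of modulus at least
one forces Kv = 0 and Q^{1/2} v = 0. Then v is an eigenvector of A + L Q^{1/2} for every L, against
detectability (`isSchurStable_closedLoop`).

Uniqueness and rates: both rest on `riccatiMap_sub_riccatiMap`. For two stabilizing solutions it is
a homogeneous Stein equation, solved only by zero. For X j and V it reads X (j+1) - V = (A + B K j)'
(X j - V) T, and K j → K makes this a vanishing perturbation of the stable operator Z ↦ T'ZT, so
`decaysExp_of_stable_recursion` applies. The gains inherit the rate; ξ obeys a similarly perturbed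
recursion with matrix T', and l follows from V and ξ. -/

/-- The real sequence `f` is bounded by a decaying geometric sequence. -/
def DecaysExp (f : ℕ → ℝ) : Prop :=
  ∃ C ρ : ℝ, 0 < C ∧ 0 < ρ ∧ ρ < 1 ∧ ∀ j, f j ≤ C * ρ ^ j

namespace DecaysExp

variable {f g : ℕ → ℝ}

theorem mono (hg : DecaysExp g) (h : ∀ j, f j ≤ g j) : DecaysExp f := by
  obtain ⟨C, ρ, hC, h0, h1, hb⟩ := hg
  exact ⟨C, ρ, hC, h0, h1, fun j => (h j).trans (hb j)⟩

theorem add (hf : DecaysExp f) (hg : DecaysExp g) : DecaysExp fun j => f j + g j := by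
  obtain ⟨C, ρ, hC, h0, h1, hb⟩ := hf
  obtain ⟨D, σ, hD, k0, k1, kb⟩ := hg
  refine ⟨C + D, max ρ σ, by positivity, lt_max_of_lt_left h0, max_lt h1 k1, fun j => ?_⟩
  have e1 : ρ ^ j ≤ max ρ σ ^ j := pow_le_pow_left₀ h0.le (le_max_left _ _) j
  have e2 : σ ^ j ≤ max ρ σ ^ j := pow_le_pow_left₀ k0.le (le_max_right _ _) j
  calc f j + g j ≤ C * ρ ^ j + D * σ ^ j := add_le_add (hb j) (kb j)
    _ ≤ C * max ρ σ ^ j + D * max ρ σ ^ j := by gcongr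
    _ = _ := by ring

theorem const_mul (hf : DecaysExp f) {a : ℝ} (ha : 0 ≤ a) : DecaysExp fun j => a * f j := by
  obtain ⟨C, ρ, hC, h0, h1, hb⟩ := hf
  -- The factor `a + 1` keeps the constant positive when `a = 0`.
  refine ⟨(a + 1) * C, ρ, by positivity, h0, h1, fun j => ?_⟩
  have : 0 ≤ C * ρ ^ j := by positivity
  nlinarith [mul_le_mul_of_nonneg_left (hb j) ha]

/-- A sequence with `y (j + 1) ≤ (ρ + δ j) y j + g j`, `ρ < 1`, `δ → 0` and `g` exponentially
decaying is exponentially decaying. -/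
theorem of_recursion {y δ g : ℕ → ℝ} {ρ : ℝ} (hρ : ρ < 1) (hy : ∀ j, 0 ≤ y j)
    (hδ : Filter.Tendsto δ Filter.atTop (nhds 0)) (hg : DecaysExp g)
    (hrec : ∀ j, y (j + 1) ≤ (ρ + δ j) * y j + g j) : DecaysExp y := by
  obtain ⟨G, σ, hG, hσ0, hσ1, hgb⟩ := hg
  -- Eventually `ρ + δ j ≤ a`; the target rate `τ` is taken above `a`, so that the gap `τ - a` can
  -- absorb the forcing `g`.
  obtain ⟨a, ha1, ha2⟩ := exists_between (max_lt hρ hσ1)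
  obtain ⟨τ, hτ1, hτ2⟩ := exists_between ha2
  have hρa : ρ < a := (le_max_left _ _).trans_lt ha1
  have hσa : σ < a := (le_max_right _ _).trans_lt ha1
  have hτ0 : 0 < τ := by linarith
  obtain ⟨J, hJ⟩ := Filter.eventually_atTop.1 (hδ.eventually (gt_mem_nhds (sub_pos.2 hρa)))
  -- The first summand handles the forcing, the sum covers the indices up to `J`.
  set M := G / (τ - a) + ∑ i ∈ Finset.range (J + 1), y i / τ ^ i with hM
  have hsum : ∀ i, 0 ≤ y i / τ ^ i := fun i => div_nonneg (hy i) (by positivity)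
  have hGpos : 0 < G / (τ - a) := div_pos hG (by linarith)
  have hMpos : 0 < M := add_pos_of_pos_of_nonneg hGpos (Finset.sum_nonneg fun i _ => hsum i)
  have hMG : G ≤ M * (τ - a) := by
    rw [← div_le_iff₀ (by linarith)]
    exact le_add_of_nonneg_right (Finset.sum_nonneg fun i _ => hsum i)
  have hinit : ∀ i ≤ J, y i ≤ M * τ ^ i := by
    intro i hi
    rw [← div_le_iff₀ (by positivity)]
    have := Finset.single_le_sum (f := fun i => y i / τ ^ i) (fun i _ => hsum i)
      (Finset.mem_range.2 (Nat.lt_succ_of_le hi))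
    linarith
  refine ⟨M, τ, hMpos, hτ0, hτ2, fun j => ?_⟩
  rcases le_total j J with h | h
  · exact hinit j h
  · induction j, h using Nat.le_induction with
    | base => exact hinit J le_rfl
    | succ j hj ih =>
      have h1 : (ρ + δ j) * y j ≤ a * (M * τ ^ j) := by
        have := hJ j hj
        calc (ρ + δ j) * y j ≤ a * y j := mul_le_mul_of_nonneg_right (by linarith) (hy j)
          _ ≤ _ := mul_le_mul_of_nonneg_left ih (by linarith)
      have h2 : g j ≤ M * (τ - a) * τ ^ j := by
        calc g j ≤ G * σ ^ j := hgb j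
          _ ≤ G * τ ^ j := by gcongr; linarith
          _ ≤ _ := mul_le_mul_of_nonneg_right hMG (by positivity)
      calc y (j + 1) ≤ _ := hrec j
        _ ≤ a * (M * τ ^ j) + M * (τ - a) * τ ^ j := add_le_add h1 h2
        _ = M * τ ^ (j + 1) := by ring

theorem tendsto_zero {E : Type*} [NormedAddCommGroup E] {x : ℕ → E}
    (h : DecaysExp fun j => ‖x j‖) : Filter.Tendsto x Filter.atTop (nhds 0) := by
  obtain ⟨C, ρ, hC, h0, h1, hb⟩ := h
  refine squeeze_zero_norm hb ?_
  simpa using (tendsto_pow_atTop_nhds_zero_of_lt_one h0.le h1).const_mul C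

end DecaysExp

/-- A sequence indexed by the number of stages to go that converges exponentially fast yields
horizon-indexed quantities that converge exponentially fast. -/
theorem convergesExp_of_decaysExp {E : Type*} [NormedAddCommGroup E] {x : ℕ → E} {L : E}
    (h : DecaysExp fun j => ‖x j - L‖) : ConvergesExp (fun N t => x (N - t)) L := by
  obtain ⟨C, ρ, hC, h0, h1, hb⟩ := h
  exact ⟨C, ρ, hC, h0, h1, fun N t _ => hb (N - t)⟩

/-- Meant for K_t and l_t, which are built from stage t + 1; the index shift costs a factor 1/ρ in
the constant. -/
theorem convergesExp_succ_of_decaysExp {E : Type*} [NormedAddCommGroup E] {x : ℕ → E} {L : E}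
    (h : DecaysExp fun j => ‖x j - L‖) : ConvergesExp (fun N t => x (N - (t + 1))) L := by
  obtain ⟨C, ρ, hC, h0, h1, hb⟩ := h
  refine ⟨C / ρ, ρ, by positivity, h0, h1, fun N t ht => (hb _).trans_eq ?_⟩
  obtain ⟨j, rfl⟩ := Nat.exists_eq_add_of_lt ht
  rw [show t + j + 1 - (t + 1) = j by omega, show t + j + 1 - t = j + 1 by omega, pow_succ]
  field_simp

/-! ### Perturbed stable linear recursions -/

section Recursion

variable {E : Type*} [NormedAddCommGroup E] {U : ℕ → E → E} {C ρ : ℝ} {x e : ℕ → E}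

/-- The scalar majorant of the recursion `x (j + 1) = U 1 (x j) + e j`. -/
def majorant (C ρ : ℝ) (x e : ℕ → E) : ℕ → ℝ
  | 0 => C * ‖x 0‖
  | j + 1 => ρ * majorant C ρ x e j + C * ‖e j‖

theorem majorant_nonneg (hC : 0 ≤ C) (hρ : 0 ≤ ρ) (j : ℕ) : 0 ≤ majorant C ρ x e j := by
  induction j with
  | zero => simp only [majorant]; positivity
  | succ j ih => simp only [majorant]; positivity

/-- Estimating ‖x j‖ alone would lose a factor `C` at every step. Bounding ‖U k (x j)‖ for all k at
once avoids this: in effect the norm becomes sup_k ρ^{-k} ‖U k x‖, for which `U 1` contracts by ρ.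
-/
theorem norm_le_majorant (hU0 : ∀ v, U 0 v = v) (hUadd : ∀ k u v, U k (u + v) = U k u + U k v)
    (hUsucc : ∀ k v, U (k + 1) v = U k (U 1 v)) (hUb : ∀ k v, ‖U k v‖ ≤ C * ρ ^ k * ‖v‖)
    (hx : ∀ j, x (j + 1) = U 1 (x j) + e j) (j : ℕ) : ‖x j‖ ≤ majorant C ρ x e j := by
  suffices H : ∀ j k, ‖U k (x j)‖ ≤ ρ ^ k * majorant C ρ x e j by simpa [hU0] using H j 0
  intro j
  induction j with
  | zero =>
    intro k
    simp only [majorant]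
    linarith [hUb k (x 0)]
  | succ j ih =>
    intro k
    rw [hx, hUadd, ← hUsucc]
    calc _ ≤ ‖U (k + 1) (x j)‖ + ‖U k (e j)‖ := norm_add_le _ _
      _ ≤ ρ ^ (k + 1) * majorant C ρ x e j + C * ρ ^ k * ‖e j‖ := add_le_add (ih _) (hUb _ _)
      _ = _ := by simp only [majorant]; ring

theorem bounded_of_stable_recursion (hU0 : ∀ v, U 0 v = v)
    (hUadd : ∀ k u v, U k (u + v) = U k u + U k v)
    (hUsucc : ∀ k v, U (k + 1) v = U k (U 1 v)) (hC : 0 ≤ C) (hρ0 : 0 ≤ ρ) (hρ1 : ρ < 1)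
    (hUb : ∀ k v, ‖U k v‖ ≤ C * ρ ^ k * ‖v‖) {s : E}
    (hx : ∀ j, x (j + 1) = U 1 (x j) + s) : ∃ M, ∀ j, ‖x j‖ ≤ M := by
  have hp : 0 < 1 - ρ := by linarith
  refine ⟨C * ‖x 0‖ + C * ‖s‖ / (1 - ρ), fun j => (norm_le_majorant (e := fun _ => s) hU0 hUadd
    hUsucc hUb hx j).trans ?_⟩
  have h0 : 0 ≤ C * ‖s‖ / (1 - ρ) := by positivity
  induction j with
  | zero => simp only [majorant]; linarith
  | succ j ih =>
    have h1 : C * ‖s‖ = C * ‖s‖ / (1 - ρ) * (1 - ρ) := by field_simp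
    have h2 : 0 ≤ C * ‖x 0‖ := by positivity
    simp only [majorant]
    nlinarith [mul_le_mul_of_nonneg_left ih hρ0]

/-- Perturbations of a stable linear recursion that are small relative to the state, up to an
exponentially decaying error, preserve exponential decay. -/
theorem decaysExp_of_stable_recursion (hU0 : ∀ v, U 0 v = v)
    (hUadd : ∀ k u v, U k (u + v) = U k u + U k v)
    (hUsucc : ∀ k v, U (k + 1) v = U k (U 1 v)) (hC : 0 ≤ C) (hρ0 : 0 ≤ ρ) (hρ1 : ρ < 1)
    (hUb : ∀ k v, ‖U k v‖ ≤ C * ρ ^ k * ‖v‖) (hx : ∀ j, x (j + 1) = U 1 (x j) + e j)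
    {ε g : ℕ → ℝ} (hε0 : ∀ j, 0 ≤ ε j) (hε : Filter.Tendsto ε Filter.atTop (nhds 0))
    (hg : DecaysExp g) (he : ∀ j, ‖e j‖ ≤ ε j * ‖x j‖ + g j) : DecaysExp fun j => ‖x j‖ := by
  have hle := norm_le_majorant (e := e) hU0 hUadd hUsucc hUb hx
  refine DecaysExp.mono (DecaysExp.of_recursion hρ1 (majorant_nonneg (x := x) (e := e) hC hρ0)
    (δ := fun j => C * ε j) (by simpa using hε.const_mul C) (hg.const_mul hC) fun j => ?_) hle
  have h1 : ‖e j‖ ≤ ε j * majorant C ρ x e j + g j :=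
    (he j).trans (add_le_add (mul_le_mul_of_nonneg_left (hle j) (hε0 j)) le_rfl)
  simp only [majorant]
  nlinarith [mul_le_mul_of_nonneg_left h1 hC]

end Recursion

/-! ### Schur stability -/

section Stability

variable {n p : ℕ}

theorem map_ofReal_mul {l m k : ℕ} (M : Matrix (Fin l) (Fin m) ℝ) (N : Matrix (Fin m) (Fin k) ℝ) :
    (M * N).map Complex.ofReal = M.map Complex.ofReal * N.map Complex.ofReal :=
  Matrix.map_mul (f := Complex.ofRealHom)

theorem map_ofReal_add {l m : ℕ} (M N : Matrix (Fin l) (Fin m) ℝ) :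
    (M + N).map Complex.ofReal = M.map Complex.ofReal + N.map Complex.ofReal :=
  Matrix.map_add _ Complex.ofReal_add M N

theorem map_ofReal_transpose {l m : ℕ} (M : Matrix (Fin l) (Fin m) ℝ) :
    (Mᵀ).map Complex.ofReal = (M.map Complex.ofReal)ᴴ := by
  ext i j; simp

theorem map_ofReal_pow (M : Matrix (Fin n) (Fin n) ℝ) (k : ℕ) :
    (M ^ k).map Complex.ofReal = M.map Complex.ofReal ^ k :=
  map_pow (Complex.ofRealHom.mapMatrix) M k

/-- The entrywise real part is a left inverse of complexification, and it is bounded because the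
space is finite-dimensional. -/
theorem exists_norm_le_map_ofReal (n : ℕ) : ∃ D : ℝ, 0 ≤ D ∧ ∀ M : Matrix (Fin n) (Fin n) ℝ,
    ‖M‖ ≤ D * ‖M.map Complex.ofReal‖ := by
  let r : Matrix (Fin n) (Fin n) ℂ →ₗ[ℝ] Matrix (Fin n) (Fin n) ℝ := Complex.reLm.mapMatrix
  refine ⟨‖LinearMap.toContinuousLinearMap r‖, ContinuousLinearMap.opNorm_nonneg _, fun M => ?_⟩
  have h := (LinearMap.toContinuousLinearMap r).le_opNorm (M.map Complex.ofReal)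
  have : (LinearMap.toContinuousLinearMap r) (M.map Complex.ofReal) = M := by
    ext i j; simp [r]
  rwa [this] at h

/-- The powers of a Schur stable matrix decay geometrically. -/
theorem IsSchurStable.exists_norm_pow_le {M : Matrix (Fin n) (Fin n) ℝ} (hM : IsSchurStable M) :
    ∃ C ρ : ℝ, 0 < C ∧ 0 < ρ ∧ ρ < 1 ∧ ∀ k, ‖M ^ k‖ ≤ C * ρ ^ k := by
  obtain ⟨D, hD, hDb⟩ := exists_norm_le_map_ofReal n
  set Z := M.map Complex.ofReal with hZ
  obtain ⟨r, hr1, hr2⟩ := ENNReal.lt_iff_exists_nnreal_btwn.1 hM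
  have hr2' : (r : ℝ) < 1 := by exact_mod_cast hr2
  obtain ⟨ρ, hρr, hρ1⟩ := exists_between hr2'
  have hρ0 : 0 < ρ := r.2.trans_lt hρr
  have hev := (spectrum.pow_nnnorm_pow_one_div_tendsto_nhds_spectralRadius Z).eventually
    (gt_mem_nhds hr1)
  obtain ⟨J, hJ⟩ := Filter.eventually_atTop.1 hev
  -- Gelfand's formula controls only large powers; starting at `J + 1` also keeps k positive, so
  -- that the k-th root can be undone.
  have hpow : ∀ k ≥ J + 1, ‖Z ^ k‖ ≤ ρ ^ k := by
    intro k hk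
    have h1 := (hJ k (by omega)).le
    have hk0 : (0 : ℝ) < k := by exact_mod_cast (by omega : 0 < k)
    rw [one_div, ENNReal.rpow_inv_le_iff hk0, ENNReal.rpow_natCast] at h1
    have h2 : ‖Z ^ k‖ ≤ (r : ℝ) ^ k := by exact_mod_cast h1
    exact h2.trans (pow_le_pow_left₀ r.2 hρr.le k)
  have hs : ∀ i, 0 ≤ ‖Z ^ i‖ / ρ ^ i := fun i => by positivity
  set c := 1 + ∑ i ∈ Finset.range (J + 1), ‖Z ^ i‖ / ρ ^ i with hc
  have hc1 : 1 ≤ c := le_add_of_nonneg_right (Finset.sum_nonneg fun i _ => hs i)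
  have hall : ∀ k, ‖Z ^ k‖ ≤ c * ρ ^ k := by
    intro k
    rcases lt_or_ge k (J + 1) with h | h
    · rw [← div_le_iff₀ (by positivity)]
      have := Finset.single_le_sum (f := fun i => ‖Z ^ i‖ / ρ ^ i) (fun i _ => hs i)
        (Finset.mem_range.2 h)
      linarith
    · exact (hpow k h).trans (le_mul_of_one_le_left (by positivity) hc1)
  refine ⟨D * c + 1, ρ, by positivity, hρ0, hρ1, fun k => ?_⟩
  calc ‖M ^ k‖ ≤ D * ‖(M ^ k).map Complex.ofReal‖ := hDb _
    _ ≤ D * (c * ρ ^ k) := by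
      rw [map_ofReal_pow]; exact mul_le_mul_of_nonneg_left (hall k) hD
    _ ≤ _ := by nlinarith [pow_pos hρ0 k]

theorem norm_transpose {l m : ℕ} (M : Matrix (Fin l) (Fin m) ℝ) : ‖Mᵀ‖ = ‖M‖ := by
  rw [← Matrix.conjTranspose_eq_transpose_of_trivial, Matrix.l2_opNorm_conjTranspose]

theorem norm_toLp_mulVec_le {l m : ℕ} (M : Matrix (Fin l) (Fin m) ℝ) (v : Fin m → ℝ) :
    ‖WithLp.toLp 2 (M *ᵥ v)‖ ≤ ‖M‖ * ‖WithLp.toLp 2 v‖ :=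
  Matrix.l2_opNorm_mulVec M (WithLp.toLp 2 v)

/-- A matrix is Schur stable if it has no complex eigenvalue of modulus at least one. -/
theorem isSchurStable_of_forall_eigenvector {M : Matrix (Fin n) (Fin n) ℝ}
    (h : ∀ (z : ℂ) (v : Fin n → ℂ), M.map Complex.ofReal *ᵥ v = z • v → 1 ≤ ‖z‖ → v = 0) :
    IsSchurStable M := by
  -- For n = 0 the matrix algebra is trivial and the spectral radius is zero; the eigenvalue
  -- argument needs n > 0.
  rcases isEmpty_or_nonempty (Fin n) with hn | hn
  · have : Subsingleton (Matrix (Fin n) (Fin n) ℂ) := inferInstance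
    simp [IsSchurStable]
  · refine spectrum.spectralRadius_lt_of_forall_lt (r := 1) _ fun z hz => ?_
    by_contra hlt
    rw [← Matrix.spectrum_toLin', ← Module.End.hasEigenvalue_iff_mem_spectrum] at hz
    obtain ⟨v, hv⟩ := hz.exists_hasEigenvector
    refine hv.2 (h z v (by simpa using hv.apply_eq_smul) ?_)
    exact_mod_cast not_lt.1 hlt

/-- A Schur stable matrix has no complex eigenvalue of modulus at least one. -/
theorem IsSchurStable.eq_zero_of_eigenvector {M : Matrix (Fin n) (Fin n) ℝ} (hM : IsSchurStable M)
    {z : ℂ} {v : Fin n → ℂ} (hv : M.map Complex.ofReal *ᵥ v = z • v) (hz : 1 ≤ ‖z‖) : v = 0 := by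
  by_contra hne
  have hev : Module.End.HasEigenvector (Matrix.toLin' (M.map Complex.ofReal)) z v :=
    Module.End.hasEigenvector_iff.2 ⟨Module.End.mem_eigenspace_iff.2 (by simpa using hv), hne⟩
  have hmem := (Module.End.hasEigenvalue_of_hasEigenvector hev).mem_spectrum
  rw [Matrix.spectrum_toLin'] at hmem
  have h1 : (‖z‖₊ : ENNReal) ≤ spectralRadius ℂ (M.map Complex.ofReal) :=
    le_iSup₂ (f := fun k (_ : k ∈ spectrum ℂ (M.map Complex.ofReal)) => (‖k‖₊ : ENNReal)) z hmem
  have h2 := h1.trans_lt hM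
  have h3 : ‖z‖ < 1 := by exact_mod_cast h2
  linarith

/-- A kernel vector of `1 - M` would be an eigenvector of `M` for the eigenvalue 1. -/
theorem IsSchurStable.isUnit_one_sub {M : Matrix (Fin n) (Fin n) ℝ} (hM : IsSchurStable M) :
    IsUnit (1 - M) := by
  rw [← Matrix.mulVec_injective_iff_isUnit]
  refine (injective_iff_map_eq_zero (Matrix.mulVecLin (1 - M))).2 fun v hv => ?_
  have h1 : M *ᵥ v = v := by
    have : v - M *ᵥ v = 0 := by simpa [Matrix.sub_mulVec] using hv
    exact (sub_eq_zero.1 this).symm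
  have h2 : (fun i => (v i : ℂ)) = 0 := by
    refine hM.eq_zero_of_eigenvector (z := 1) ?_ (by simp)
    funext i
    have := congrArg Complex.ofReal (congrFun h1 i)
    simpa [Matrix.mulVec, dotProduct] using this
  funext i
  simpa using congrFun h2 i

/-- The bound that makes `X ↦ MᵀXN` a stable operator. -/
theorem norm_transpose_pow_mul_mul_pow_le {M N : Matrix (Fin n) (Fin n) ℝ} {C ρ D σ : ℝ}
    (hC : ∀ k, ‖M ^ k‖ ≤ C * ρ ^ k) (hD : ∀ k, ‖N ^ k‖ ≤ D * σ ^ k) (k : ℕ)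
    (X : Matrix (Fin n) (Fin n) ℝ) :
    ‖(M ^ k)ᵀ * X * N ^ k‖ ≤ C * D * (ρ * σ) ^ k * ‖X‖ := by
  calc _ ≤ ‖(M ^ k)ᵀ‖ * ‖X‖ * ‖N ^ k‖ :=
        (norm_mul_le _ _).trans (mul_le_mul_of_nonneg_right (norm_mul_le _ _) (norm_nonneg _))
    _ ≤ (C * ρ ^ k) * ‖X‖ * (D * σ ^ k) := by
        rw [norm_transpose]
        have := hC k
        have := hD k
        have := (norm_nonneg _).trans (hC k)
        gcongr
    _ = _ := by rw [mul_pow]; ring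

/-- The homogeneous Stein equation with stable coefficients has only the zero solution. -/
theorem eq_zero_of_eq_transpose_mul_mul {M N X : Matrix (Fin n) (Fin n) ℝ}
    (hM : IsSchurStable M) (hN : IsSchurStable N) (hX : X = Mᵀ * X * N) : X = 0 := by
  obtain ⟨C, ρ, hC, h0, h1, hb⟩ := hM.exists_norm_pow_le
  obtain ⟨D, σ, hD, k0, k1, kb⟩ := hN.exists_norm_pow_le
  have hk : ∀ k, X = (M ^ k)ᵀ * X * N ^ k := by
    intro k
    induction k with
    | zero => simp
    | succ k ih =>
      calc X = (M ^ k)ᵀ * (Mᵀ * X * N) * N ^ k := by rw [← hX]; exact ih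
        _ = _ := by
          rw [pow_succ' M, pow_succ' N, Matrix.transpose_mul]
          simp only [Matrix.mul_assoc]
  -- Iterating the equation bounds the constant ‖X‖ by a decaying sequence.
  have hd : DecaysExp fun _ : ℕ => ‖X‖ := by
    refine ⟨C * D * ‖X‖ + 1, ρ * σ, by positivity, by positivity, by nlinarith, fun k => ?_⟩
    have h2 := norm_transpose_pow_mul_mul_pow_le hb kb k X
    rw [← hk k] at h2
    have : 0 < (ρ * σ) ^ k := by positivity
    nlinarith
  exact tendsto_nhds_unique tendsto_const_nhds hd.tendsto_zero

end Stability

/-! ### Algebra of the Riccati map -/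

section RiccatiAlgebra

variable {n p : ℕ} {A : Matrix (Fin n) (Fin n) ℝ} {B : Matrix (Fin n) (Fin p) ℝ}
  {R : Matrix (Fin p) (Fin p) ℝ} {S V V' : Matrix (Fin n) (Fin n) ℝ}

theorem _root_.Matrix.PosSemidef.isSymm {m : ℕ} {M : Matrix (Fin m) (Fin m) ℝ}
    (h : M.PosSemidef) : M.IsSymm := by
  simpa [Matrix.IsHermitian, Matrix.IsSymm] using h.isHermitian

theorem _root_.Matrix.PosSemidef.transpose_mul_mul_same {m l : ℕ} {M : Matrix (Fin m) (Fin m) ℝ}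
    (h : M.PosSemidef) (F : Matrix (Fin m) (Fin l) ℝ) : (Fᵀ * M * F).PosSemidef := by
  simpa using h.conjTranspose_mul_mul_same F

theorem posDef_input_penalty (hV : V.PosSemidef) (hR : R.PosDef) : (Bᵀ * V * B + R).PosDef :=
  hR.posSemidef_add (hV.transpose_mul_mul_same B)

theorem mul_gain (hG : IsUnit (Bᵀ * V * B + R)) :
    (Bᵀ * V * B + R) * gain A B R V = -(Bᵀ * V * A) := by
  have h := Matrix.mul_nonsing_inv _ ((Matrix.isUnit_iff_isUnit_det _).1 hG)
  rw [gain, Matrix.mul_neg, Matrix.mul_assoc _ Bᵀ V, Matrix.mul_assoc _ (Bᵀ * V) A,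
    ← Matrix.mul_assoc, h, Matrix.one_mul]

/-- First-order optimality of the gain. -/
theorem transpose_mul_closedLoop (hG : IsUnit (Bᵀ * V * B + R)) :
    Bᵀ * V * (A + B * gain A B R V) = -(R * gain A B R V) := by
  have h := mul_gain (A := A) hG
  rw [Matrix.add_mul] at h
  rw [Matrix.mul_add, ← Matrix.mul_assoc, eq_neg_iff_add_eq_zero, add_assoc, h, add_neg_cancel]

theorem riccatiMap_eq_mul_closedLoop :
    riccatiMap A B R S V = Aᵀ * V * (A + B * gain A B R V) + S := by
  simp only [riccatiMap, gain, Matrix.mul_add, Matrix.mul_neg, Matrix.mul_assoc]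
  abel

/-- The one-stage cost matrix of the feedback `F` followed by the cost `V`. -/
def feedbackCost (A : Matrix (Fin n) (Fin n) ℝ) (B : Matrix (Fin n) (Fin p) ℝ)
    (R : Matrix (Fin p) (Fin p) ℝ) (S V : Matrix (Fin n) (Fin n) ℝ)
    (F : Matrix (Fin p) (Fin n) ℝ) : Matrix (Fin n) (Fin n) ℝ :=
  (A + B * F)ᵀ * V * (A + B * F) + (S + Fᵀ * R * F)

/-- Completion of the square. -/
theorem feedbackCost_eq (hV : V.IsSymm) (hR : R.IsSymm) (hG : IsUnit (Bᵀ * V * B + R))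
    (F : Matrix (Fin p) (Fin n) ℝ) :
    feedbackCost A B R S V F = riccatiMap A B R S V +
      (F - gain A B R V)ᵀ * (Bᵀ * V * B + R) * (F - gain A B R V) := by
  set K := gain A B R V with hK
  set G := Bᵀ * V * B + R with hGdef
  have h1 : G * K = -(Bᵀ * V * A) := mul_gain hG
  have hGt : Gᵀ = G := by
    simp [hGdef, Matrix.transpose_mul, hV.eq, hR.eq, Matrix.mul_assoc]
  have h2 : Kᵀ * G = -(Aᵀ * V * B) := by
    have := congrArg Matrix.transpose h1
    simpa [Matrix.transpose_mul, hGt, hV.eq, Matrix.mul_assoc] using this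
  have h3 : (F - K)ᵀ * G * (F - K) =
      Fᵀ * (Bᵀ * V * B) * F + Fᵀ * R * F + Fᵀ * (Bᵀ * V * A) + Aᵀ * V * B * F
        - Aᵀ * V * B * K := by
    rw [Matrix.transpose_sub, Matrix.sub_mul, h2, Matrix.mul_sub, Matrix.sub_mul, Matrix.sub_mul,
      Matrix.mul_assoc _ G K, h1, hGdef]
    simp only [Matrix.mul_add, Matrix.add_mul, Matrix.mul_neg, Matrix.neg_mul]
    abel
  rw [h3, riccatiMap_eq_mul_closedLoop, ← hK, feedbackCost]
  simp only [Matrix.transpose_add, Matrix.transpose_mul, Matrix.mul_add, Matrix.add_mul,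
    Matrix.mul_assoc]
  abel

theorem feedbackCost_gain (hV : V.IsSymm) (hR : R.IsSymm) (hG : IsUnit (Bᵀ * V * B + R)) :
    feedbackCost A B R S V (gain A B R V) = riccatiMap A B R S V := by
  rw [feedbackCost_eq hV hR hG]
  simp

/-- The excess in the completed square is a congruence of the positive definite B'VB + R. -/
theorem riccatiMap_le_feedbackCost (hV : V.PosSemidef) (hR : R.PosDef)
    (F : Matrix (Fin p) (Fin n) ℝ) : riccatiMap A B R S V ≤ feedbackCost A B R S V F := by
  have hG := posDef_input_penalty (B := B) hV hR
  rw [Matrix.le_iff, feedbackCost_eq hV.isSymm hR.posSemidef.isSymm hG.isUnit, add_sub_cancel_left]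
  exact hG.posSemidef.transpose_mul_mul_same _

theorem feedbackCost_mono (h : V ≤ V') (F : Matrix (Fin p) (Fin n) ℝ) :
    feedbackCost A B R S V F ≤ feedbackCost A B R S V' F := by
  rw [Matrix.le_iff] at h ⊢
  have e : feedbackCost A B R S V' F - feedbackCost A B R S V F =
      (A + B * F)ᵀ * (V' - V) * (A + B * F) := by
    rw [feedbackCost, feedbackCost, add_sub_add_right_eq_sub, Matrix.mul_sub, Matrix.sub_mul]
  rw [e]
  exact h.transpose_mul_mul_same (A + B * F)

/-- The optimal gain for `V'` is merely admissible for `V`, and each fixed-feedback cost is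
monotone. -/
theorem riccatiMap_mono (hV : V.PosSemidef) (hV' : V'.PosSemidef) (hR : R.PosDef) (h : V ≤ V') :
    riccatiMap A B R S V ≤ riccatiMap A B R S V' :=
  calc _ ≤ feedbackCost A B R S V (gain A B R V') := riccatiMap_le_feedbackCost hV hR _
    _ ≤ feedbackCost A B R S V' (gain A B R V') := feedbackCost_mono h _
    _ = _ := feedbackCost_gain hV'.isSymm hR.posSemidef.isSymm (posDef_input_penalty hV' hR).isUnit

theorem le_riccatiMap (hV : V.PosSemidef) (hR : R.PosDef) : S ≤ riccatiMap A B R S V := by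
  rw [← feedbackCost_gain hV.isSymm hR.posSemidef.isSymm (posDef_input_penalty hV hR).isUnit,
    Matrix.le_iff, feedbackCost, add_sub_assoc, add_sub_cancel_left]
  exact (hV.transpose_mul_mul_same (A + B * gain A B R V)).add
    (hR.posSemidef.transpose_mul_mul_same (gain A B R V))

/-- The difference of two values of the Riccati map factors through the two closed loops. -/
theorem riccatiMap_sub_riccatiMap (hV : V.IsSymm) (hR : R.IsSymm)
    (hG : IsUnit (Bᵀ * V * B + R)) (hG' : IsUnit (Bᵀ * V' * B + R)) :
    riccatiMap A B R S V - riccatiMap A B R S V' =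
      (A + B * gain A B R V)ᵀ * (V - V') * (A + B * gain A B R V') := by
  set K := gain A B R V with hK
  set K' := gain A B R V' with hK'
  have e := transpose_mul_closedLoop (A := A) hG
  have e' := transpose_mul_closedLoop (A := A) hG'
  rw [← hK] at e
  rw [← hK'] at e'
  have et : (A + B * K)ᵀ * V * B = -(Kᵀ * R) := by
    have := congrArg Matrix.transpose e
    rw [Matrix.transpose_mul, Matrix.transpose_mul, Matrix.transpose_transpose, hV.eq,
      Matrix.transpose_neg, Matrix.transpose_mul, hR.eq, ← Matrix.mul_assoc] at this
    exact this
  -- Optimality of K for V, and of K' for V', produces the same cross term `Kᵀ * R * K'` in `f1` and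
  -- `f2`; it cancels in the difference.
  have f1 : (A + B * K)ᵀ * V * (A + B * K') = (A + B * K)ᵀ * V * A - Kᵀ * R * K' := by
    rw [Matrix.mul_add, ← Matrix.mul_assoc _ B K', et, Matrix.neg_mul, sub_eq_add_neg]
  have f2 : (A + B * K)ᵀ * V' * (A + B * K') = Aᵀ * V' * (A + B * K') - Kᵀ * R * K' := by
    rw [Matrix.transpose_add, Matrix.transpose_mul, Matrix.add_mul, Matrix.add_mul,
      Matrix.mul_assoc Kᵀ, Matrix.mul_assoc Kᵀ, e', Matrix.mul_neg, sub_eq_add_neg,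
      Matrix.mul_assoc Kᵀ]
  -- Both sides equal the symmetric expression (A + BK)'V(A + BK) + K'RK.
  have f3 : Aᵀ * V * (A + B * K) = (A + B * K)ᵀ * V * A := by
    have g1 : Aᵀ * V * (A + B * K) = (A + B * K)ᵀ * V * (A + B * K) + Kᵀ * R * K := by
      rw [Matrix.transpose_add, Matrix.transpose_mul, Matrix.add_mul, Matrix.add_mul,
        Matrix.mul_assoc Kᵀ, Matrix.mul_assoc Kᵀ, e, Matrix.mul_neg, Matrix.mul_assoc Kᵀ]
      abel
    rw [g1, Matrix.mul_add, ← Matrix.mul_assoc _ B K, et, Matrix.neg_mul]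
    abel
  rw [Matrix.mul_sub, Matrix.sub_mul, f1, f2, riccatiMap_eq_mul_closedLoop,
    riccatiMap_eq_mul_closedLoop, ← hK, ← hK', f3]
  abel

/-- Two stabilizing solutions coincide. -/
theorem IsStabilizingSolution.unique (hR : R.IsSymm) (h : IsStabilizingSolution A B R S V)
    (h' : IsStabilizingSolution A B R S V') : V' = V := by
  refine sub_eq_zero.1 (eq_zero_of_eq_transpose_mul_mul h'.stable h.stable ?_)
  rw [← riccatiMap_sub_riccatiMap (S := S) h'.symm hR h'.isUnit h.isUnit, ← h.dare,
    ← h'.dare]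

/-- The deviation of gains is linear in the deviation of the cost matrices. -/
theorem gain_sub_gain (hG : IsUnit (Bᵀ * V * B + R)) (hG' : IsUnit (Bᵀ * V' * B + R)) :
    gain A B R V' - gain A B R V =
      (Bᵀ * V' * B + R)⁻¹ * (Bᵀ * (V - V') * (A + B * gain A B R V)) := by
  have h := Matrix.nonsing_inv_mul _ ((Matrix.isUnit_iff_isUnit_det _).1 hG')
  have e := mul_gain (A := A) hG'
  have e' := transpose_mul_closedLoop (A := A) hG
  have key : (Bᵀ * V' * B + R) * (gain A B R V' - gain A B R V) =
      Bᵀ * (V - V') * (A + B * gain A B R V) := by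
    rw [Matrix.mul_sub, e, Matrix.mul_sub, Matrix.sub_mul, e', Matrix.mul_add, Matrix.add_mul,
      ← Matrix.mul_assoc _ B]
    abel
  rw [← key, ← Matrix.mul_assoc, h, Matrix.one_mul]

theorem mul_affineTerm (hG : IsUnit (Bᵀ * V * B + R)) (w ξ : Fin n → ℝ) :
    (Bᵀ * V * B + R) *ᵥ affineTerm B R w V ξ = -(Bᵀ *ᵥ (ξ + V *ᵥ w)) := by
  have h := Matrix.mul_nonsing_inv _ ((Matrix.isUnit_iff_isUnit_det _).1 hG)
  rw [affineTerm, Matrix.mulVec_neg, Matrix.mulVec_mulVec, ← Matrix.mul_assoc, h, Matrix.one_mul]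

/-- The deviation of the affine inputs. -/
theorem affineTerm_sub_affineTerm (hG : IsUnit (Bᵀ * V * B + R))
    (hG' : IsUnit (Bᵀ * V' * B + R)) (w ξ ξ' : Fin n → ℝ) :
    affineTerm B R w V' ξ' - affineTerm B R w V ξ =
      ((Bᵀ * V' * B + R)⁻¹ * Bᵀ) *ᵥ ((V - V') *ᵥ (w + B *ᵥ affineTerm B R w V ξ) - (ξ' - ξ)) := by
  have h := Matrix.nonsing_inv_mul _ ((Matrix.isUnit_iff_isUnit_det _).1 hG')
  have e := mul_affineTerm hG w ξ
  have e' := mul_affineTerm hG' w ξ'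
  set l := affineTerm B R w V ξ
  have key : (Bᵀ * V' * B + R) *ᵥ (affineTerm B R w V' ξ' - l) =
      Bᵀ *ᵥ ((V - V') *ᵥ (w + B *ᵥ l) - (ξ' - ξ)) := by
    -- The equation for `V` eliminates `R`, leaving only differences of the data.
    have e2 : R *ᵥ l = -(Bᵀ *ᵥ (ξ + V *ᵥ w)) - (Bᵀ * V * B) *ᵥ l := by
      rw [← e, Matrix.add_mulVec]; abel
    rw [Matrix.mulVec_sub, e', Matrix.add_mulVec, e2]
    simp only [Matrix.sub_mulVec, Matrix.mulVec_add, Matrix.mulVec_sub, Matrix.mulVec_mulVec,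
      Matrix.mul_assoc, Matrix.sub_mul]
    abel
  rw [← Matrix.mulVec_mulVec, ← key, Matrix.mulVec_mulVec, h, Matrix.one_mulVec]

end RiccatiAlgebra

/-! ### Monotone limits of matrices -/

section Limits

variable {n p : ℕ}

theorem exists_norm_le_of_tendsto {E : Type*} [NormedAddCommGroup E] {x : ℕ → E} {L : E}
    (h : Filter.Tendsto x Filter.atTop (nhds L)) : ∃ M, 0 ≤ M ∧ ∀ j, ‖x j‖ ≤ M := by
  obtain ⟨M, hM⟩ := (Metric.isBounded_range_of_tendsto x h).exists_norm_le
  exact ⟨M, (norm_nonneg _).trans (hM _ ⟨0, rfl⟩), fun j => hM _ ⟨j, rfl⟩⟩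

theorem dotProduct_mulVec_le (M : Matrix (Fin n) (Fin n) ℝ) (v : Fin n → ℝ) :
    v ⬝ᵥ M *ᵥ v ≤ ‖M‖ * ‖WithLp.toLp 2 v‖ ^ 2 := by
  have h := real_inner_le_norm (WithLp.toLp 2 (M *ᵥ v)) (WithLp.toLp 2 v)
  rw [EuclideanSpace.inner_toLp_toLp] at h
  have h2 := norm_toLp_mulVec_le M v
  simp only [star_trivial] at h
  nlinarith [norm_nonneg (WithLp.toLp 2 v)]

/-- Polarization: convergence of quadratic forms then gives convergence of entries. -/
theorem entry_eq_of_isSymm {M : Matrix (Fin n) (Fin n) ℝ} (hM : M.IsSymm) (i k : Fin n) :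
    M i k = ((Pi.single i 1 + Pi.single k 1) ⬝ᵥ M *ᵥ (Pi.single i 1 + Pi.single k 1)
      - Pi.single i 1 ⬝ᵥ M *ᵥ Pi.single i 1 - Pi.single k 1 ⬝ᵥ M *ᵥ Pi.single k 1) / 2 := by
  have : M k i = M i k := hM.apply i k
  simp only [Matrix.mulVec_add, add_dotProduct, dotProduct_add, Matrix.mulVec_single_one,
    single_one_dotProduct, Matrix.col_apply, this]
  ring

/-- A monotone sequence of symmetric matrices dominated by a norm-bounded one converges. -/
theorem exists_tendsto_of_monotone {X Y : ℕ → Matrix (Fin n) (Fin n) ℝ} {M : ℝ}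
    (hsymm : ∀ j, (X j).IsSymm) (hmono : ∀ j, X j ≤ X (j + 1)) (hle : ∀ j, X j ≤ Y j)
    (hY : ∀ j, ‖Y j‖ ≤ M) : ∃ V, Filter.Tendsto X Filter.atTop (nhds V) := by
  have quad : ∀ {P Q : Matrix (Fin n) (Fin n) ℝ}, P ≤ Q → ∀ v : Fin n → ℝ,
      v ⬝ᵥ P *ᵥ v ≤ v ⬝ᵥ Q *ᵥ v := by
    intro P Q h v
    have := (Matrix.le_iff.1 h).dotProduct_mulVec_nonneg v
    rw [star_trivial, Matrix.sub_mulVec, dotProduct_sub] at this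
    linarith
  have hlim : ∀ v : Fin n → ℝ, ∃ l, Filter.Tendsto (fun j => v ⬝ᵥ X j *ᵥ v)
      Filter.atTop (nhds l) := fun v =>
    ⟨_, tendsto_atTop_ciSup (monotone_nat_of_le_succ fun j => quad (hmono j) v)
      ⟨M * ‖WithLp.toLp 2 v‖ ^ 2, by
        rintro _ ⟨j, rfl⟩
        exact (quad (hle j) v).trans ((dotProduct_mulVec_le _ _).trans (by gcongr; exact hY j))⟩⟩
  choose l hl using hlim
  refine ⟨Matrix.of fun i k => (l (Pi.single i 1 + Pi.single k 1) - l (Pi.single i 1)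
    - l (Pi.single k 1)) / 2, tendsto_pi_nhds.2 fun i => tendsto_pi_nhds.2 fun k => ?_⟩
  have := (((hl (Pi.single i 1 + Pi.single k 1)).sub (hl (Pi.single i 1))).sub
    (hl (Pi.single k 1))).div_const 2
  exact this.congr fun j => (entry_eq_of_isSymm (hsymm j) i k).symm

theorem posSemidef_of_tendsto {X : ℕ → Matrix (Fin n) (Fin n) ℝ} {V : Matrix (Fin n) (Fin n) ℝ}
    (hX : ∀ j, (X j).PosSemidef) (h : Filter.Tendsto X Filter.atTop (nhds V)) :
    V.PosSemidef := by
  refine Matrix.PosSemidef.of_dotProduct_mulVec_nonneg ?_ fun v => ?_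
  · have h1 : Filter.Tendsto (fun j => (X j)ᴴ) Filter.atTop (nhds Vᴴ) :=
      ((continuous_id.matrix_conjTranspose).tendsto V).comp h
    exact tendsto_nhds_unique h1 (h.congr fun j => (hX j).isHermitian.symm)
  · have h1 : Filter.Tendsto (fun j => star v ⬝ᵥ X j *ᵥ v) Filter.atTop
        (nhds (star v ⬝ᵥ V *ᵥ v)) :=
      ((by fun_prop : Continuous fun Z : Matrix (Fin n) (Fin n) ℝ =>
        star v ⬝ᵥ Z *ᵥ v).tendsto V).comp h
    exact ge_of_tendsto' h1 fun j => (hX j).dotProduct_mulVec_nonneg v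

variable {A : Matrix (Fin n) (Fin n) ℝ} {B : Matrix (Fin n) (Fin p) ℝ}
  {R : Matrix (Fin p) (Fin p) ℝ} {S V : Matrix (Fin n) (Fin n) ℝ}

theorem continuousAt_inv_input_penalty (hG : IsUnit (Bᵀ * V * B + R)) :
    ContinuousAt (fun Z => (Bᵀ * Z * B + R)⁻¹) V := by
  have h1 : ContinuousAt (fun M : Matrix (Fin p) (Fin p) ℝ => M⁻¹) (Bᵀ * V * B + R) := by
    refine continuousAt_matrix_inv _ ?_
    rw [Ring.inverse_eq_inv']
    exact continuousAt_inv₀ ((Matrix.isUnit_iff_isUnit_det _).1 hG).ne_zero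
  exact ContinuousAt.comp (f := fun Z => Bᵀ * Z * B + R) h1 (by fun_prop)

theorem continuousAt_gain (hG : IsUnit (Bᵀ * V * B + R)) : ContinuousAt (gain A B R) V :=
  ContinuousAt.comp (f := fun Z => (Z, (Bᵀ * Z * B + R)⁻¹))
    (g := fun q : Matrix (Fin n) (Fin n) ℝ × Matrix (Fin p) (Fin p) ℝ =>
      -(q.2 * Bᵀ * q.1 * A)) (by fun_prop)
    (continuousAt_id.prodMk (continuousAt_inv_input_penalty hG))

theorem continuousAt_riccatiMap (hG : IsUnit (Bᵀ * V * B + R)) :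
    ContinuousAt (riccatiMap A B R S) V := by
  have : riccatiMap A B R S = fun Z => Aᵀ * Z * (A + B * gain A B R Z) + S := by
    funext Z; exact riccatiMap_eq_mul_closedLoop
  rw [this]
  exact ContinuousAt.comp (f := fun Z => (Z, gain A B R Z))
    (g := fun q : Matrix (Fin n) (Fin n) ℝ × Matrix (Fin p) (Fin n) ℝ =>
      Aᵀ * q.1 * (A + B * q.2) + S) (by fun_prop)
    (continuousAt_id.prodMk (continuousAt_gain hG))

end Limits

/-! ### Stability of the closed loop -/

section ClosedLoop

open scoped ComplexOrder

variable {n p : ℕ} {A : Matrix (Fin n) (Fin n) ℝ} {B : Matrix (Fin n) (Fin p) ℝ}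
  {R : Matrix (Fin p) (Fin p) ℝ} {Q S V : Matrix (Fin n) (Fin n) ℝ}

/-- A Gram factorization through the square root survives complexification. -/
theorem _root_.Matrix.PosSemidef.map_ofReal {m : ℕ} {M : Matrix (Fin m) (Fin m) ℝ}
    (h : M.PosSemidef) : (M.map Complex.ofReal).PosSemidef := by
  have h0 : (0 : Matrix (Fin m) (Fin m) ℝ) ≤ M := Matrix.nonneg_iff_posSemidef.2 h
  have h1 : (CFC.sqrt M)ᵀ = CFC.sqrt M :=
    (Matrix.nonneg_iff_posSemidef.1 (CFC.sqrt_nonneg M)).isSymm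
  have h2 : M = (CFC.sqrt M)ᵀ * CFC.sqrt M := by rw [h1, CFC.sqrt_mul_sqrt_self M h0]
  rw [h2, map_ofReal_mul, map_ofReal_transpose]
  exact Matrix.posSemidef_conjTranspose_mul_self _

/-- If the state penalty dominates a penalty `Q` with `(A, Q^{1/2})` detectable, then positive
semidefinite solutions of the Riccati equation are stabilizing. -/
theorem isSchurStable_closedLoop (hdet : IsDetectable A (CFC.sqrt Q)) (hQ : Q.PosSemidef)
    (hQS : Q ≤ S) (hR : R.PosDef) (hV : V.PosSemidef) (hdare : V = riccatiMap A B R S V) :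
    IsSchurStable (A + B * gain A B R V) := by
  obtain ⟨L, hL⟩ := hdet
  refine isSchurStable_of_forall_eigenvector fun z v hzv hz => ?_
  set K := gain A B R V with hK
  -- Splitting S as Q + (S - Q) makes every term a nonnegative quadratic form.
  have heq : V = (A + B * K)ᵀ * V * (A + B * K) + (Q + (S - Q) + Kᵀ * R * K) := by
    rw [add_sub_cancel]
    conv_lhs => rw [hdare, ← feedbackCost_gain hV.isSymm hR.posSemidef.isSymm
      (posDef_input_penalty hV hR).isUnit]
    rfl
  have hc := congrArg (fun M => star v ⬝ᵥ (M.map Complex.ofReal) *ᵥ v) heq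
  simp only [map_ofReal_add, map_ofReal_mul (_ * _), map_ofReal_mul _ V, map_ofReal_mul _ R,
    map_ofReal_transpose, Matrix.add_mulVec, dotProduct_add] at hc
  have conj : ∀ {m : ℕ} (F : Matrix (Fin m) (Fin n) ℂ) (M : Matrix (Fin m) (Fin m) ℂ),
      star v ⬝ᵥ (Fᴴ * M * F) *ᵥ v = star (F *ᵥ v) ⬝ᵥ M *ᵥ (F *ᵥ v) := by
    intro m F M
    rw [Matrix.star_mulVec, ← Matrix.dotProduct_mulVec, Matrix.mulVec_mulVec, Matrix.mulVec_mulVec,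
      Matrix.mul_assoc]
  rw [conj, conj, ← map_ofReal_add, hzv] at hc
  have hVq := hV.map_ofReal.dotProduct_mulVec_nonneg v
  have hQq := hQ.map_ofReal.dotProduct_mulVec_nonneg v
  have hSq := (Matrix.le_iff.1 hQS).map_ofReal.dotProduct_mulVec_nonneg v
  have hRq := hR.posSemidef.map_ofReal.dotProduct_mulVec_nonneg (K.map Complex.ofReal *ᵥ v)
  have hzz : star (z • v) ⬝ᵥ V.map Complex.ofReal *ᵥ (z • v) =
      ((‖z‖ ^ 2 : ℝ) : ℂ) * (star v ⬝ᵥ V.map Complex.ofReal *ᵥ v) := by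
    rw [star_smul, Matrix.mulVec_smul, smul_dotProduct, dotProduct_smul, smul_eq_mul, smul_eq_mul,
      ← mul_assoc, Complex.star_def, Complex.conj_mul']
    norm_cast
  rw [hzz] at hc
  rw [Complex.nonneg_iff] at hVq hQq hSq hRq
  have hre := congrArg Complex.re hc
  simp only [Complex.add_re, Complex.re_ofReal_mul] at hre
  have hz2 : 1 ≤ ‖z‖ ^ 2 := one_le_pow₀ hz
  -- The forms of Q, S - Q and K'RK at v add up to (1 - |z|²) v*Vv ≤ 0, so each of them vanishes.
  have hmul : (star v ⬝ᵥ V.map Complex.ofReal *ᵥ v).re ≤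
      ‖z‖ ^ 2 * (star v ⬝ᵥ V.map Complex.ofReal *ᵥ v).re := le_mul_of_one_le_left hVq.1 hz2
  have hQ0 : star v ⬝ᵥ Q.map Complex.ofReal *ᵥ v = 0 :=
    Complex.ext (by simp only [Complex.zero_re]; linarith [hQq.1, hSq.1, hRq.1]) hQq.2.symm
  have hR0 : star (K.map Complex.ofReal *ᵥ v) ⬝ᵥ R.map Complex.ofReal *ᵥ
      (K.map Complex.ofReal *ᵥ v) = 0 :=
    Complex.ext (by simp only [Complex.zero_re]; linarith [hQq.1, hSq.1, hRq.1]) hRq.2.symm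
  have hKv : K.map Complex.ofReal *ᵥ v = 0 := by
    have h1 := (hR.posSemidef.map_ofReal.dotProduct_mulVec_zero_iff _).1 hR0
    have h2 : R⁻¹.map Complex.ofReal * R.map Complex.ofReal = 1 := by
      rw [← map_ofReal_mul, Matrix.nonsing_inv_mul _ ((Matrix.isUnit_iff_isUnit_det _).1 hR.isUnit)]
      exact Matrix.map_one _ Complex.ofReal_zero Complex.ofReal_one
    have h3 := congrArg (R⁻¹.map Complex.ofReal *ᵥ ·) h1
    simpa [Matrix.mulVec_mulVec, ← Matrix.mul_assoc, h2] using h3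
  have hCv : (CFC.sqrt Q).map Complex.ofReal *ᵥ v = 0 := by
    have h1 : (CFC.sqrt Q)ᵀ = CFC.sqrt Q :=
      (Matrix.nonneg_iff_posSemidef.1 (CFC.sqrt_nonneg Q)).isSymm
    have h2 : Q = (CFC.sqrt Q)ᵀ * CFC.sqrt Q := by
      rw [h1, CFC.sqrt_mul_sqrt_self Q (Matrix.nonneg_iff_posSemidef.2 hQ)]
    rw [h2, map_ofReal_mul, map_ofReal_transpose, ← Matrix.mulVec_mulVec, Matrix.dotProduct_mulVec,
      ← Matrix.star_mulVec] at hQ0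
    exact dotProduct_star_self_eq_zero.1 hQ0
  -- Both A + BK and A + L Q^{1/2} now act on v as A does.
  refine hL.eq_zero_of_eigenvector (z := z) ?_ hz
  rw [map_ofReal_add, map_ofReal_mul, Matrix.add_mulVec, ← Matrix.mulVec_mulVec, hKv,
    Matrix.mulVec_zero, add_zero] at hzv
  rw [map_ofReal_add, map_ofReal_mul, Matrix.add_mulVec, ← Matrix.mulVec_mulVec, hCv,
    Matrix.mulVec_zero, add_zero, hzv]

end ClosedLoop

/-! ### Convergence of the Riccati iteration -/

section Convergence

variable {n p : ℕ} {A : Matrix (Fin n) (Fin n) ℝ} {B : Matrix (Fin n) (Fin p) ℝ}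
  {R : Matrix (Fin p) (Fin p) ℝ} {S V : Matrix (Fin n) (Fin n) ℝ} {c w : Fin n → ℝ}

theorem posSemidef_riccatiToGo (hS : S.PosSemidef) (hR : R.PosDef) (j : ℕ) :
    (riccatiToGo A B R S j).PosSemidef := by
  induction j with
  | zero => exact hS
  | succ j ih =>
    exact Matrix.nonneg_iff_posSemidef.1
      ((Matrix.nonneg_iff_posSemidef.2 hS).trans (le_riccatiMap ih hR))

theorem isUnit_input_penalty_riccatiToGo (hS : S.PosSemidef) (hR : R.PosDef) (j : ℕ) :
    IsUnit (Bᵀ * riccatiToGo A B R S j * B + R) :=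
  (posDef_input_penalty (posSemidef_riccatiToGo hS hR j) hR).isUnit

theorem riccatiToGo_le_succ (hS : S.PosSemidef) (hR : R.PosDef) (j : ℕ) :
    riccatiToGo A B R S j ≤ riccatiToGo A B R S (j + 1) := by
  induction j with
  | zero => exact le_riccatiMap hS hR
  | succ j ih =>
    exact riccatiMap_mono (posSemidef_riccatiToGo hS hR j) (posSemidef_riccatiToGo hS hR (j + 1))
      hR ih

theorem transpose_pow_succ_mul_mul (M N X : Matrix (Fin n) (Fin n) ℝ) (k : ℕ) :
    (M ^ (k + 1))ᵀ * X * N ^ (k + 1) = (M ^ k)ᵀ * ((M ^ 1)ᵀ * X * N ^ 1) * N ^ k := by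
  rw [pow_succ' M, pow_succ' N, Matrix.transpose_mul, pow_one, pow_one]
  simp only [Matrix.mul_assoc]

/-- The Riccati iteration of a stabilizable system converges. -/
theorem exists_tendsto_riccatiToGo (hstab : IsStabilizable A B) (hS : S.PosSemidef)
    (hR : R.PosDef) :
    ∃ V, Filter.Tendsto (riccatiToGo A B R S) Filter.atTop (nhds V) := by
  obtain ⟨F, hF⟩ := hstab
  obtain ⟨C, ρ, hC, h0, h1, hb⟩ := hF.exists_norm_pow_le
  -- The cost-to-go of the fixed stabilizing feedback F.
  let Y : ℕ → Matrix (Fin n) (Fin n) ℝ := fun j => (fun Z => feedbackCost A B R S Z F)^[j] S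
  have hYs : ∀ j, Y (j + 1) = feedbackCost A B R S (Y j) F := fun j =>
    Function.iterate_succ_apply' _ _ _
  have hle : ∀ j, riccatiToGo A B R S j ≤ Y j := by
    intro j
    induction j with
    | zero => exact le_rfl
    | succ j ih =>
      rw [hYs]
      exact (riccatiMap_le_feedbackCost (posSemidef_riccatiToGo hS hR j) hR F).trans
        (feedbackCost_mono ih F)
  obtain ⟨M, hM⟩ := bounded_of_stable_recursion
    (U := fun k X => ((A + B * F) ^ k)ᵀ * X * (A + B * F) ^ k) (x := Y) (C := C * C) (ρ := ρ * ρ)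
    (by simp) (fun k X Z => by rw [Matrix.mul_add, Matrix.add_mul])
    (fun k X => transpose_pow_succ_mul_mul _ _ X k) (by positivity) (by positivity) (by nlinarith)
    (norm_transpose_pow_mul_mul_pow_le hb hb) (s := S + Fᵀ * R * F)
    (fun j => by simp only [hYs, feedbackCost, pow_one])
  exact exists_tendsto_of_monotone (fun j => (posSemidef_riccatiToGo hS hR j).isSymm)
    (riccatiToGo_le_succ hS hR) hle hM

/-- The limit of the Riccati iteration solves the Riccati equation. -/
theorem dare_of_tendsto (hS : S.PosSemidef) (hR : R.PosDef)
    (hV : Filter.Tendsto (riccatiToGo A B R S) Filter.atTop (nhds V)) :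
    V = riccatiMap A B R S V := by
  have hpsd := posSemidef_of_tendsto (posSemidef_riccatiToGo hS hR) hV
  have h1 := (continuousAt_riccatiMap (A := A) (S := S)
    (posDef_input_penalty (B := B) hpsd hR).isUnit).tendsto.comp hV
  exact tendsto_nhds_unique (hV.comp (Filter.tendsto_add_atTop_nat 1)) h1

theorem tendsto_norm_gain_sub
    (hsol : IsStabilizingSolution A B R S V)
    (hV : Filter.Tendsto (riccatiToGo A B R S) Filter.atTop (nhds V)) : Filter.Tendsto
    (fun j => ‖gain A B R (riccatiToGo A B R S j) - gain A B R V‖) Filter.atTop (nhds 0) :=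
  tendsto_iff_norm_sub_tendsto_zero.1 ((continuousAt_gain hsol.isUnit).tendsto.comp hV)

/-- The Riccati iterates converge exponentially fast. -/
theorem decaysExp_riccatiToGo
    (hS : S.PosSemidef) (hR : R.PosDef)
    (hsol : IsStabilizingSolution A B R S V)
    (hV : Filter.Tendsto (riccatiToGo A B R S) Filter.atTop (nhds V)) :
    DecaysExp fun j => ‖riccatiToGo A B R S j - V‖ := by
  obtain ⟨C, ρ, hC, h0, h1, hb⟩ := hsol.stable.exists_norm_pow_le
  set T := A + B * gain A B R V with hT
  let K := fun j => gain A B R (riccatiToGo A B R S j)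
  have hK := tendsto_norm_gain_sub hsol hV
  -- Replacing the current closed loop by T on the left leaves the error (B(K j - K))'(X j - V)T,
  -- which is small relative to the state; hence `g = 0`, with an arbitrary decay witness.
  refine decaysExp_of_stable_recursion
    (U := fun k X => (T ^ k)ᵀ * X * T ^ k) (C := C * C) (ρ := ρ * ρ)
    (e := fun j => ((B * (K j - gain A B R V))ᵀ * (riccatiToGo A B R S j - V) * T))
    (ε := fun j => ‖B‖ * ‖K j - gain A B R V‖ * ‖T‖) (g := fun _ => 0)
    (by simp) (fun k X Z => by rw [Matrix.mul_add, Matrix.add_mul])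
    (fun k X => transpose_pow_succ_mul_mul _ _ X k) (by positivity) (by positivity) (by nlinarith)
    (norm_transpose_pow_mul_mul_pow_le hb hb) (fun j => ?_) (fun j => by positivity)
    (by simpa using (hK.const_mul ‖B‖).mul_const ‖T‖)
    ⟨1, 1 / 2, by norm_num, by norm_num, by norm_num, fun j => by positivity⟩ (fun j => ?_)
  · have h := riccatiMap_sub_riccatiMap (A := A) (S := S)
      (posSemidef_riccatiToGo (A := A) (B := B) hS hR j).isSymm hR.posSemidef.isSymm
      (isUnit_input_penalty_riccatiToGo hS hR j) hsol.isUnit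
    rw [← hsol.dare, ← hT] at h
    simp only [pow_one]
    have hTj : A + B * gain A B R (riccatiToGo A B R S j) =
        T + B * (K j - gain A B R V) := by
      simp only [hT, K, Matrix.mul_sub]; abel
    rw [hTj, Matrix.transpose_add, Matrix.add_mul, Matrix.add_mul] at h
    exact h
  · simp only [add_zero]
    calc _ ≤ ‖(B * (K j - gain A B R V))ᵀ‖ * ‖riccatiToGo A B R S j - V‖ * ‖T‖ :=
          (norm_mul_le _ _).trans (mul_le_mul_of_nonneg_right (norm_mul_le _ _) (norm_nonneg _))
      _ ≤ (‖B‖ * ‖K j - gain A B R V‖) * ‖riccatiToGo A B R S j - V‖ * ‖T‖ := by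
          rw [norm_transpose]
          gcongr
          exact Matrix.l2_opNorm_mul _ _
      _ = _ := by ring

theorem exists_norm_inv_input_penalty_le
    (hsol : IsStabilizingSolution A B R S V)
    (hV : Filter.Tendsto (riccatiToGo A B R S) Filter.atTop (nhds V)) :
    ∃ M, 0 ≤ M ∧ ∀ j, ‖(Bᵀ * riccatiToGo A B R S j * B + R)⁻¹‖ ≤ M :=
  exists_norm_le_of_tendsto ((continuousAt_inv_input_penalty hsol.isUnit).tendsto.comp hV)

/-- The gains converge exponentially fast. -/
theorem decaysExp_gain
    (hS : S.PosSemidef) (hR : R.PosDef)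
    (hsol : IsStabilizingSolution A B R S V)
    (hV : Filter.Tendsto (riccatiToGo A B R S) Filter.atTop (nhds V)) :
    DecaysExp fun j => ‖gain A B R (riccatiToGo A B R S j) - gain A B R V‖ := by
  obtain ⟨M, hM0, hM⟩ := exists_norm_inv_input_penalty_le hsol hV
  refine ((decaysExp_riccatiToGo hS hR hsol hV).const_mul
    (a := M * (‖Bᵀ‖ * ‖A + B * gain A B R V‖)) (by positivity)).mono fun j => ?_
  rw [gain_sub_gain hsol.isUnit (isUnit_input_penalty_riccatiToGo hS hR j)]
  calc _ ≤ ‖(Bᵀ * riccatiToGo A B R S j * B + R)⁻¹‖ *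
        (‖Bᵀ‖ * ‖V - riccatiToGo A B R S j‖ * ‖A + B * gain A B R V‖) :=
        (Matrix.l2_opNorm_mul _ _).trans (mul_le_mul_of_nonneg_left
          ((Matrix.l2_opNorm_mul _ _).trans (mul_le_mul_of_nonneg_right
            (Matrix.l2_opNorm_mul _ _) (norm_nonneg _))) (norm_nonneg _))
    _ ≤ M * (‖Bᵀ‖ * ‖V - riccatiToGo A B R S j‖ * ‖A + B * gain A B R V‖) := by
        gcongr; exact hM j
    _ = _ := by rw [norm_sub_rev]; ring

theorem isUnit_one_sub_transpose_closedLoop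
    (hsol : IsStabilizingSolution A B R S V) : IsUnit (1 - (A + B * gain A B R V)ᵀ) := by
  have h := hsol.stable.isUnit_one_sub
  rw [← Matrix.isUnit_transpose] at h
  simpa only [Matrix.transpose_sub, Matrix.transpose_one] using h

/-- This fixed-point form can be subtracted from the recursion for ξ. -/
theorem xiLimit_eq
    (hsol : IsStabilizingSolution A B R S V) : xiLimit A B R c w V =
    (A + B * gain A B R V)ᵀ *ᵥ (xiLimit A B R c w V + V *ᵥ w) + c := by
  set T := A + B * gain A B R V with hT
  have h1 : (1 - Tᵀ) *ᵥ xiLimit A B R c w V = Tᵀ *ᵥ (V *ᵥ w) + c := by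
    have := isUnit_one_sub_transpose_closedLoop hsol
    rw [← hT] at this
    rw [xiLimit, Matrix.mulVec_mulVec,
      Matrix.mul_nonsing_inv _ ((Matrix.isUnit_iff_isUnit_det _).1 this), Matrix.one_mulVec]
  rw [Matrix.sub_mulVec, Matrix.one_mulVec, sub_eq_iff_eq_add] at h1
  rw [Matrix.mulVec_add]
  refine h1.trans ?_
  abel

/-- The linear cost coefficients converge exponentially fast. -/
theorem decaysExp_xiToGo
    (hS : S.PosSemidef) (hR : R.PosDef)
    (hsol : IsStabilizingSolution A B R S V)
    (hV : Filter.Tendsto (riccatiToGo A B R S) Filter.atTop (nhds V)) : DecaysExp fun j =>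
    ‖WithLp.toLp 2 (xiToGo A B R S c w j) - WithLp.toLp 2 (xiLimit A B R c w V)‖ := by
  obtain ⟨C, ρ, hC, h0, h1, hb⟩ := hsol.stable.exists_norm_pow_le
  have hfix := xiLimit_eq (c := c) (w := w) hsol
  have hKt := tendsto_norm_gain_sub hsol hV
  have hKd := decaysExp_gain hS hR hsol hV
  have hVd := decaysExp_riccatiToGo hS hR hsol hV
  obtain ⟨M, hM0, hM⟩ := exists_norm_le_of_tendsto hV
  set ξ := xiLimit A B R c w V
  set T := A + B * gain A B R V with hT
  let D := fun j => gain A B R (riccatiToGo A B R S j) - gain A B R V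
  let X := riccatiToGo A B R S
  have hDn : ∀ j v, ‖WithLp.toLp 2 ((B * D j)ᵀ *ᵥ v)‖ ≤ ‖B‖ * ‖D j‖ * ‖WithLp.toLp 2 v‖ := by
    intro j v
    refine (norm_toLp_mulVec_le _ _).trans (mul_le_mul_of_nonneg_right ?_ (norm_nonneg _))
    rw [norm_transpose]
    exact Matrix.l2_opNorm_mul _ _
  -- The current closed loop is T + B D j. The error `e` has one part proportional to the deviation
  -- of ξ and two parts driven by D j and X j - V, whose decay is already known.
  refine decaysExp_of_stable_recursion
    (U := fun k v => WithLp.toLp 2 ((T ^ k)ᵀ *ᵥ v.ofLp)) (C := C) (ρ := ρ)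
    (e := fun j => WithLp.toLp 2 ((B * D j)ᵀ *ᵥ (xiToGo A B R S c w j - ξ)) +
      (WithLp.toLp 2 ((B * D j)ᵀ *ᵥ (ξ + X j *ᵥ w)) +
        WithLp.toLp 2 (Tᵀ *ᵥ ((X j - V) *ᵥ w))))
    (ε := fun j => ‖B‖ * ‖D j‖)
    (g := fun j => ‖B‖ * (‖WithLp.toLp 2 ξ‖ + M * ‖WithLp.toLp 2 w‖) * ‖D j‖ +
      ‖T‖ * ‖WithLp.toLp 2 w‖ * ‖X j - V‖)
    (by simp) (fun k u v => by simp [Matrix.mulVec_add])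
    (fun k v => by
      simp only [Matrix.mulVec_mulVec, pow_one]
      rw [← Matrix.transpose_mul, ← pow_succ'])
    hC.le h0.le h1 (fun k v => ?_) (fun j => ?_) (fun j => by positivity)
    (by simpa using hKt.const_mul ‖B‖)
    ((hKd.const_mul (by positivity)).add (hVd.const_mul (by positivity))) (fun j => ?_)
  · refine (norm_toLp_mulVec_le _ _).trans ?_
    rw [norm_transpose]
    exact mul_le_mul_of_nonneg_right (hb k) (norm_nonneg _)
  · have hTj : A + B * gain A B R (X j) = T + B * D j := by
      simp only [hT, D, X, Matrix.mul_sub]; abel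
    have hx : xiToGo A B R S c w (j + 1) =
        (A + B * gain A B R (X j))ᵀ *ᵥ (xiToGo A B R S c w j + X j *ᵥ w) + c := rfl
    rw [hx, hTj, pow_one]
    conv_lhs => rw [hfix]
    simp only [← WithLp.toLp_sub, ← WithLp.toLp_add]
    congr 1
    simp only [Matrix.transpose_add, Matrix.add_mulVec, Matrix.mulVec_add, Matrix.mulVec_sub,
      Matrix.sub_mulVec]
    abel
  · refine (norm_add_le _ _).trans (add_le_add ?_ ((norm_add_le _ _).trans (add_le_add ?_ ?_)))
    · rw [← WithLp.toLp_sub]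
      exact hDn j _
    · refine (hDn j _).trans ?_
      have : ‖WithLp.toLp 2 (ξ + X j *ᵥ w)‖ ≤ ‖WithLp.toLp 2 ξ‖ + M * ‖WithLp.toLp 2 w‖ := by
        rw [WithLp.toLp_add]
        refine (norm_add_le _ _).trans (add_le_add le_rfl ((norm_toLp_mulVec_le _ _).trans ?_))
        gcongr
        exact hM j
      calc _ ≤ ‖B‖ * ‖D j‖ * (‖WithLp.toLp 2 ξ‖ + M * ‖WithLp.toLp 2 w‖) := by gcongr
        _ = _ := by ring
    · calc _ ≤ ‖T‖ * (‖X j - V‖ * ‖WithLp.toLp 2 w‖) := by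
            refine (norm_toLp_mulVec_le _ _).trans ?_
            rw [norm_transpose]
            gcongr
            exact norm_toLp_mulVec_le _ _
        _ = _ := by ring

/-- The affine inputs converge exponentially fast. -/
theorem decaysExp_affineTerm
    (hS : S.PosSemidef) (hR : R.PosDef)
    (hsol : IsStabilizingSolution A B R S V)
    (hV : Filter.Tendsto (riccatiToGo A B R S) Filter.atTop (nhds V)) : DecaysExp fun j =>
    ‖WithLp.toLp 2 (affineTerm B R w (riccatiToGo A B R S j) (xiToGo A B R S c w j)) -
      WithLp.toLp 2 (affineTerm B R w V (xiLimit A B R c w V))‖ := by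
  obtain ⟨M, hM0, hM⟩ := exists_norm_inv_input_penalty_le hsol hV
  have hVd := decaysExp_riccatiToGo hS hR hsol hV
  have hξd := decaysExp_xiToGo (c := c) (w := w) hS hR hsol hV
  set l := affineTerm B R w V (xiLimit A B R c w V) with hl
  refine (((hVd.const_mul (norm_nonneg (WithLp.toLp 2 (w + B *ᵥ l)))).add hξd).const_mul
    (a := M * ‖Bᵀ‖) (by positivity)).mono fun j => ?_
  rw [← WithLp.toLp_sub, hl, affineTerm_sub_affineTerm hsol.isUnit
    (isUnit_input_penalty_riccatiToGo hS hR j), ← hl]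
  refine (norm_toLp_mulVec_le _ _).trans (mul_le_mul ((Matrix.l2_opNorm_mul _ _).trans
    (mul_le_mul_of_nonneg_right (hM j) (norm_nonneg _))) ?_ (norm_nonneg _) (by positivity))
  rw [WithLp.toLp_sub, WithLp.toLp_sub]
  refine (norm_sub_le _ _).trans (add_le_add ((norm_toLp_mulVec_le _ _).trans ?_) le_rfl)
  rw [norm_sub_rev, mul_comm]

end Convergence

/-! ### The noise covariance -/

section Noise

variable {n : ℕ} {Ω : Type*} [MeasurableSpace Ω] {P : Measure Ω} [IsProbabilityMeasure P]
  {X : Ω → EuclideanSpace ℝ (Fin n)}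

theorem memLp_centered (hX : MemLp X 2 P) (i : Fin n) :
    MemLp (fun ω => centered P X ω i) 2 P :=
  (hX.eval_piLp i).sub (memLp_const _)

/-- The quadratic form at v is the expectation of (v · δ)². -/
theorem posSemidef_covMat (hX : MemLp X 2 P) : (covMat P X).PosSemidef := by
  have hint : ∀ i j, Integrable (fun ω => centered P X ω i * centered P X ω j) P := fun i j =>
    (memLp_centered hX i).integrable_mul (memLp_centered hX j)
  refine Matrix.PosSemidef.of_dotProduct_mulVec_nonneg ?_ fun v => ?_
  · ext i j
    simp [covMat, mul_comm]
  · have h : star v ⬝ᵥ covMat P X *ᵥ v = ∫ ω, (v ⬝ᵥ centered P X ω) ^ 2 ∂P := by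
      have h1 : ∀ ω, (v ⬝ᵥ centered P X ω) ^ 2 =
          ∑ i, ∑ j, v i * (centered P X ω i * centered P X ω j * v j) := by
        intro ω
        rw [sq, dotProduct, Finset.sum_mul_sum]
        exact Finset.sum_congr rfl fun i _ => Finset.sum_congr rfl fun j _ => by ring
      simp_rw [h1]
      rw [integral_finsetSum _ fun i _ => integrable_finsetSum _ fun j _ =>
        ((hint i j).mul_const _).const_mul _]
      simp only [dotProduct, Matrix.mulVec, star_trivial, covMat, Matrix.of_apply, Finset.mul_sum]
      refine Finset.sum_congr rfl fun i _ => ?_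
      rw [integral_finsetSum _ fun j _ => ((hint i j).mul_const _).const_mul _]
      exact Finset.sum_congr rfl fun j _ => by rw [integral_const_mul, integral_mul_const]
    rw [h]
    exact integral_nonneg fun ω => sq_nonneg _

theorem le_inflated {Q W : Matrix (Fin n) (Fin n) ℝ} {μ : ℝ} (hμ : 0 ≤ μ) (hQ : Q.PosSemidef)
    (hW : W.PosSemidef) : Q ≤ inflated μ Q W := by
  rw [Matrix.le_iff, inflated, add_sub_cancel_left]
  have h := hW.transpose_mul_mul_same Q
  rw [hQ.isSymm.eq] at h
  exact h.smul (by positivity)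

end Noise

end RiskLQR

end

open RiskLQR in
theorem mainTheorem5 {n p : ℕ} {Ω : Type*} [MeasurableSpace Ω]
    (P : Measure Ω) [IsProbabilityMeasure P]
    (w : ℕ → Ω → EuclideanSpace ℝ (Fin n))
    (hw_indep : iIndepFun w P)
    (hw_ident : ∀ t, IdentDistrib (w t) (w 0) P P)
    (hw_moment : ∀ t, MemLp (w t) 4 P)
    (A : Matrix (Fin n) (Fin n) ℝ) (B : Matrix (Fin n) (Fin p) ℝ)
    (Q : Matrix (Fin n) (Fin n) ℝ) (R : Matrix (Fin p) (Fin p) ℝ)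
    (hstab : IsStabilizable A B) (hdet : IsDetectable A (CFC.sqrt Q))
    (hQ : Q.PosSemidef) (hR : R.PosDef)
    (μ : ℝ) (hμ : 0 ≤ μ)
    (wbar : Fin n → ℝ) (hwbar : wbar = meanVec P (w 0))
    (W : Matrix (Fin n) (Fin n) ℝ) (hW : W = covMat P (w 0))
    (m₃ : Fin n → ℝ) (hm₃ : m₃ = thirdMoment P Q (w 0))
    (Qμ : Matrix (Fin n) (Fin n) ℝ) (hQμ : Qμ = inflated μ Q W) :
    (∀ N t, t ≤ N → IsUnit (Bᵀ * Vseq A B R Qμ N t * B + R)) ∧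
    ∃ V : Matrix (Fin n) (Fin n) ℝ,
      IsStabilizingSolution A B R Qμ V ∧
      (∀ V', IsStabilizingSolution A B R Qμ V' → V' = V) ∧
      V.PosSemidef ∧
      ConvergesExp (fun N t => Vseq A B R Qμ N t) V ∧
      ConvergesExp (fun N t => Kseq A B R Qμ N t) (gain A B R V) ∧
      IsUnit (1 - (A + B * gain A B R V)ᵀ) ∧
      ConvergesExp (fun N t => WithLp.toLp 2 (xiSeq A B R Qμ (μ • m₃) wbar N t))
        (WithLp.toLp 2 (xiLimit A B R (μ • m₃) wbar V)) ∧
      ConvergesExp (fun N t => WithLp.toLp 2 (lSeq A B R Qμ (μ • m₃) wbar N t))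
        (WithLp.toLp 2 (affineTerm B R wbar V (xiLimit A B R (μ • m₃) wbar V))) ∧
      IsSchurStable (A + B * gain A B R V) := by
  subst hwbar hW hm₃ hQμ
  have hW := posSemidef_covMat ((hw_moment 0).mono_exponent (by norm_num : (2 : ENNReal) ≤ 4))
  have hQS := le_inflated hμ hQ hW
  have hS : (inflated μ Q (covMat P (w 0))).PosSemidef :=
    Matrix.nonneg_iff_posSemidef.1 ((Matrix.nonneg_iff_posSemidef.2 hQ).trans hQS)
  obtain ⟨V, hV⟩ := exists_tendsto_riccatiToGo hstab hS hR
  have hpsd := posSemidef_of_tendsto (posSemidef_riccatiToGo hS hR) hV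
  have hdare := dare_of_tendsto hS hR hV
  have hsol : IsStabilizingSolution A B R (inflated μ Q (covMat P (w 0))) V :=
    ⟨hpsd.isSymm, (posDef_input_penalty hpsd hR).isUnit, hdare,
      isSchurStable_closedLoop hdet hQ hQS hR hpsd hdare⟩
  exact ⟨fun N t _ => isUnit_input_penalty_riccatiToGo hS hR (N - t), V, hsol,
    fun V' h' => hsol.unique hR.posSemidef.isSymm h', hpsd,
    convergesExp_of_decaysExp (decaysExp_riccatiToGo hS hR hsol hV),
    convergesExp_succ_of_decaysExp (decaysExp_gain hS hR hsol hV),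
    isUnit_one_sub_transpose_closedLoop hsol,
    convergesExp_of_decaysExp (decaysExp_xiToGo hS hR hsol hV),
    convergesExp_succ_of_decaysExp (decaysExp_affineTerm hS hR hsol hV), hsol.stable⟩
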